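/- Let $\mathsf G=(\mathsf V,\mathsf E)$ be a finite quiver without self-loops, the edge $e$ going from its source $s(e)$ to its target $t(e)\neq s(e)$; several edges with the same source and target are allowed. Let $\underline n=(n_a)_{a\in\mathsf V}$ be positive integers and let $\underline x=(x_e)_{e\in\mathsf E}$ be complex numbers. A representation of $\mathsf G$ with ranks $\underline n$ is a family $\underline U=(U_e)_{e\in\mathsf E}$ of complex matrices, $U_e$ of size $n_{s(e)}\times n_{t(e)}$. Its twisted Laplacian is the endomorphism $\Delta=\Delta(\underline x,\underline U)$ of $\prod_{a\in\mathsf V}\mathbb C^{n_a}$ given by $$(\Delta f)(a)=\sum_{e\in\mathsf E:\,s(e)=a}x_e\big[f(a)-U_e f(t(e))\big].$$ A cycle $c$ on $\mathsf G$ is a sequence of edges $(e_1,\dots,e_m)$, $m\geq 1$, with $t(e_i)=s(e_{i+1})$ for $1\leq i<m$ and $t(e_m)=s(e_1)$, considered up to cyclic permutation (edges and vertices may be repeated). Put $\underline x^{\underline e(c)}=x_{e_1}\cdots x_{e_m}$ and $\operatorname{Tr}\operatorname{hol}(c)=\operatorname{Tr}(U_{e_1}\cdots U_{e_m})$; let $v_a(c)$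 be the number of $i$ with $s(e_i)=a$; and let the valuation $\operatorname{val}(c)$ be the number of elements of $\mathbb Z/m\mathbb Z$ whose action by cyclic permutation fixes $(e_1,\dots,e_m)$. For a finite multiset $\mathsf C$ of cycles let $v_a(\mathsf C)=\sum_{c\in\mathsf C}v_a(c)$, and let $\mathsf C!$ be the product of the factorials of the multiplicities of its elements; sums and products over $c\in\mathsf C$ take multiplicities into account. Let $\mathcal C(\mathsf G)_{\leq\underline n}$ be the set of the finite multisets $\mathsf C$ of cycles on $\mathsf G$ (the empty one included) with $v_a(\mathsf C)\leq n_a$ for all $a\in\mathsf V$; this set is finite. Finally, let $z_a=\sum_{e:\,s(e)=a}x_e$ and $\underline z^{\underline n-\underline v(\mathsf C)}=\prod_{a\in\mathsf V}z_a^{n_a-v_a(\mathsf C)}$. **Theorem.** Let $\underline U$ be distributed according to any probability measure on the space of representations of $\mathsf G$ with ranks $\underline n$, and let $k\geq 1$ be an integer such that for all $\mathsf C_1,\dots,\mathsf C_k\in\mathcal C(\mathsf G)_{\leq\underline n}$ the random variable $\prod_{i=1}^k\prod_{c\in\mathsf C_i}\operatorname{Tr}\operatorname{hol}(c)$ is integrable.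 Then $(\det\Delta)^k$ is integrable, and $$\mathbb E\big[(\det\Delta)^k\big]=\sum_{\mathsf C_1,\dots,\mathsf C_k\in\mathcal C(\mathsf G)_{\leq\underline n}}\left(\prod_{i=1}^k\left[\frac{\underline z^{\underline n-\underline v(\mathsf C_i)}}{\mathsf C_i!}\prod_{c\in\mathsf C_i}\frac{-\underline x^{\underline e(c)}}{\operatorname{val}(c)}\right]\right)\mathbb E\left[\prod_{i=1}^k\prod_{c\in\mathsf C_i}\operatorname{Tr}\operatorname{hol}(c)\right].$$ -/

import Mathlib

open MeasureTheory
open scoped Nat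

universe u v

namespace QuiverRep

section Walks

variable {V : Type u} [Quiver.{v} V]

/-- An oriented edge of the quiver `V`: its source, its target, and the arrow. -/
abbrev Edge (V : Type u) [Quiver.{v} V] : Type (max u v) := Σ a b : V, (a ⟶ b)

/-- The list of the edges traversed by a path, in the order of traversal. -/
def edges {a : V} : {b : V} → Quiver.Path a b → List (Edge V)
  | _, .nil => []
  | _, .cons p e => edges p ++ [⟨_, _, e⟩]

/-- A closed walk: a base vertex and a path with at least one edge from this vertex to itself. -/
structure ClosedWalk (V : Type u) [Quiver.{v} V] where
  /-- the base vertex -/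
  base : V
  /-- the path that is traversed -/
  path : Quiver.Path base base
  pos : 0 < path.length

/-- Two closed walks are equivalent if their edge sequences differ by a cyclic permutation. -/
instance ClosedWalk.setoid (V : Type u) [Quiver.{v} V] : Setoid (ClosedWalk V) where
  r p q := (edges p.path).IsRotated (edges q.path)
  iseqv :=
    ⟨fun _ => List.IsRotated.refl _, fun h => h.symm, fun h h' => h.trans h'⟩

/-- A cycle on the quiver: a non-empty well-chained sequence of edges that comes back to its
starting vertex, up to cyclic permutation. Vertices and edges may be visited several times. -/
def Cyc (V : Type u) [Quiver.{v} V] : Type (max u v) := Quotient (ClosedWalk.setoid V)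

theorem length_edges {a b : V} (p : Quiver.Path a b) : (edges p).length = p.length := by
  induction p with
  | nil => rfl
  | cons p e ih => simp [edges, ih]

theorem edges_comp {a b c : V} (p : Quiver.Path a b) (q : Quiver.Path b c) :
    edges (p.comp q) = edges p ++ edges q := by
  induction q with
  | nil => simp [edges]
  | cons q e ih => simp [edges, ih]

/-- A path can be cut wherever its edge sequence is cut. -/
theorem exists_comp_of_edges_eq_append {a b : V} (p : Quiver.Path a b) :
    ∀ l₁ l₂ : List (Edge V), edges p = l₁ ++ l₂ →
      ∃ (c : V) (r : Quiver.Path a c) (s : Quiver.Path c b),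
        p = r.comp s ∧ edges r = l₁ ∧ edges s = l₂ := by
  induction p with
  | nil =>
    intro l₁ l₂ h
    obtain ⟨rfl, rfl⟩ : l₁ = [] ∧ l₂ = [] := by simpa [edges] using h
    exact ⟨a, .nil, .nil, rfl, rfl, rfl⟩
  | cons p e ih =>
    intro l₁ l₂ h
    rcases List.eq_nil_or_concat l₂ with rfl | ⟨l₃, f, rfl⟩
    · exact ⟨_, p.cons e, .nil, rfl, by simpa using h, rfl⟩
    · have h' : edges p ++ [⟨_, _, e⟩] = (l₁ ++ l₃) ++ [f] := by simpa [edges] using h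
      obtain ⟨h1, h2⟩ := List.append_inj' h' rfl
      obtain ⟨c, r, s, rfl, hr, hs⟩ := ih _ _ h1
      refine ⟨c, r, s.cons e, rfl, hr, ?_⟩
      simp [edges, hs, ← List.singleton_inj.1 h2]

/-- A path with a given end is determined by its edge sequence. -/
theorem eq_of_edges_eq {a b : V} (p : Quiver.Path a b) :
    ∀ {a' : V} (q : Quiver.Path a' b), edges p = edges q → a = a' ∧ p ≍ q := by
  induction p with
  | nil =>
    intro a' q h
    cases q with
    | nil => exact ⟨rfl, HEq.rfl⟩
    | cons q e => simp [edges] at h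
  | cons p e ih =>
    intro a' q h
    cases q with
    | nil => simp [edges] at h
    | cons q e' =>
      obtain ⟨h1, h2⟩ := List.append_inj' (s₁ := edges p) (s₂ := edges q) h rfl
      have h3 := List.singleton_inj.1 h2
      simp only [Sigma.mk.injEq] at h3
      obtain ⟨rfl, h4⟩ := h3
      simp only [heq_eq_eq, Sigma.mk.injEq, true_and] at h4
      subst h4
      obtain ⟨rfl, h5⟩ := ih q h1
      cases h5
      exact ⟨rfl, HEq.rfl⟩

theorem ClosedWalk.eq_of_edges_eq (p q : ClosedWalk V) (h : edges p.path = edges q.path) :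
    p = q := by
  obtain ⟨a, p, hp⟩ := p
  obtain ⟨b, q, hq⟩ := q
  have hab : a = b := by
    cases p with
    | nil => simp at hp
    | cons p e =>
      cases q with
      | nil => simp at hq
      | cons q e' =>
        obtain ⟨-, h2⟩ := List.append_inj' (s₁ := edges p) (s₂ := edges q) h rfl
        have h3 := List.singleton_inj.1 h2
        exact congrArg (fun e : Edge V => e.2.1) h3
  subst hab
  obtain ⟨-, h⟩ := QuiverRep.eq_of_edges_eq p q h
  cases h
  rfl

/-- Equivalent closed walks differ by a move of the base vertex. -/
theorem ClosedWalk.exists_comp_of_equiv {p q : ClosedWalk V} (h : p ≈ q) :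
    ∃ r : Quiver.Path p.base q.base, ∃ s : Quiver.Path q.base p.base,
      p.path = r.comp s ∧ q.path = s.comp r := by
  obtain ⟨m, hm, h⟩ := List.isRotated_iff_mod.1 h
  rw [List.rotate_eq_drop_append_take hm] at h
  obtain ⟨c, r, s, hp, hr, hs⟩ :=
    exists_comp_of_edges_eq_append p.path _ _ (List.take_append_drop m (edges p.path)).symm
  have hpos : 0 < (s.comp r).length := by
    have := p.pos
    rw [hp] at this
    simpa [add_comm] using this
  have hq : q = ⟨c, s.comp r, hpos⟩ := by
    apply ClosedWalk.eq_of_edges_eq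
    rw [edges_comp, hr, hs, h]
  subst hq
  exact ⟨r, s, hp, rfl⟩

/-! ### Length, visits, valuation -/

/-- The length of a cycle. -/
def Cyc.length (c : Cyc V) : ℕ :=
  Quotient.lift (fun p : ClosedWalk V => (edges p.path).length)
    (fun _ _ h => List.Perm.length_eq (List.IsRotated.perm h)) c

open Classical in
/-- The number of visits of a cycle at the vertex `a`: the number of the edges that it traverses,
with multiplicity, whose source is `a`. -/
noncomputable def Cyc.visits (c : Cyc V) (a : V) : ℕ :=
  Quotient.lift (fun p : ClosedWalk V => ((edges p.path).map fun e => e.1).count a)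
    (fun _ _ h => List.Perm.count_eq ((List.IsRotated.perm h).map _) a) c

theorem card_rotate_eq_self {α : Type*} {l l' : List α} (h : l.IsRotated l') :
    Nat.card {i : Fin l.length // l.rotate i = l} =
      Nat.card {i : Fin l'.length // l'.rotate i = l'} := by
  obtain ⟨m, rfl⟩ := h
  refine Nat.card_congr ((finCongr (List.length_rotate l m).symm).subtypeEquiv fun i => ?_)
  simp only [finCongr_apply, Fin.val_cast]
  rw [List.rotate_rotate, add_comm, ← List.rotate_rotate, List.rotate_eq_rotate]

/-- The valuation of a cycle of length `k`: the number of the elements of `ℤ/kℤ` (represented by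
`0, …, k - 1`) which, acting by rotation, leave its sequence of edges unchanged. -/
noncomputable def Cyc.valuation (c : Cyc V) : ℕ :=
  Quotient.lift
    (fun p : ClosedWalk V =>
      Nat.card {i : Fin (edges p.path).length // (edges p.path).rotate i = edges p.path})
    (fun _ _ h => card_rotate_eq_self h) c

/-- The monomial of a cycle in the edge weights: the product of the weights of the edges that it
traverses, with multiplicity. -/
def Cyc.monomial (x : ∀ a b : V, (a ⟶ b) → ℂ) (c : Cyc V) : ℂ :=
  Quotient.lift (fun p : ClosedWalk V => ((edges p.path).map fun e => x e.1 e.2.1 e.2.2).prod)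
    (fun _ _ h => List.Perm.prod_eq ((List.IsRotated.perm h).map _)) c

/-! ### Representations and holonomies -/

/-- Representations of the quiver with rank `n a` at the vertex `a`: an `n a × n b` complex matrix
for each edge from `a` to `b`. -/
abbrev Rep (n : V → ℕ) : Type (max u v) :=
  ∀ a b : V, (a ⟶ b) → Matrix (Fin (n a)) (Fin (n b)) ℂ

/-- The σ-algebra on the space of representations that is generated by the matrix entries. This is
also the Borel σ-algebra when the quiver is finite. -/
noncomputable instance Rep.measurableSpace (n : V → ℕ) : MeasurableSpace (Rep n) :=
  inferInstanceAs (MeasurableSpace (∀ a b : V, (a ⟶ b) → Fin (n a) → Fin (n b) → ℂ))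

/-- The holonomy `U e₁ * ⋯ * U eₖ` along a path with edges `e₁, …, eₖ`. -/
def hol {n : V → ℕ} (U : Rep n) {a : V} :
    {b : V} → Quiver.Path a b → Matrix (Fin (n a)) (Fin (n b)) ℂ
  | _, .nil => 1
  | _, .cons p e => hol U p * U _ _ e

theorem hol_comp {n : V → ℕ} (U : Rep n) {a b c : V} (p : Quiver.Path a b)
    (q : Quiver.Path b c) : hol U (p.comp q) = hol U p * hol U q := by
  induction q with
  | nil => simp [hol]
  | cons q e ih => simp [hol, ih, Matrix.mul_assoc]

/-- The trace of the holonomy along a cycle, which does not depend on the base vertex. -/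
def Cyc.traceHol {n : V → ℕ} (U : Rep n) (c : Cyc V) : ℂ :=
  Quotient.lift (fun p : ClosedWalk V => (hol U p.path).trace)
    (fun p q h => by
      obtain ⟨r, s, hp, hq⟩ := ClosedWalk.exists_comp_of_equiv h
      rw [hp, hq, hol_comp, hol_comp, Matrix.trace_mul_comm]) c

/-! ### Multisets of cycles -/

/-- The total number of visits at the vertex `a` of a multiset of cycles. -/
noncomputable def visits (C : Multiset (Cyc V)) (a : V) : ℕ := (C.map fun c => c.visits a).sum

open Classical in
/-- The product of the factorials of the multiplicities of the elements of a multiset. -/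
noncomputable def multFactorial (C : Multiset (Cyc V)) : ℕ :=
  ∏ c ∈ C.toFinset, (C.count c)!

/-- The multisets of cycles whose total number of visits at each vertex `a` is at most `n a`. -/
def Admissible (n : V → ℕ) : Type (max u v) :=
  {C : Multiset (Cyc V) // ∀ a, visits C a ≤ n a}

theorem Cyc.length_pos (c : Cyc V) : 0 < c.length := by
  induction c using Quotient.inductionOn with
  | _ p =>
    change 0 < (edges p.path).length
    exact (length_edges p.path).symm ▸ p.pos

end Walks

section Finite

variable {V : Type u} [Quiver.{v} V] [Fintype V]

theorem Cyc.sum_visits (c : Cyc V) : ∑ a, c.visits a = c.length := by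
  classical
  induction c using Quotient.inductionOn with
  | _ p =>
    have h := Multiset.sum_count_eq_card (s := Finset.univ)
      (m := (((edges p.path).map fun e => e.1 : List V) : Multiset V)) (by simp)
    simp only [Multiset.coe_count, Multiset.coe_card, List.length_map] at h
    rw [← show _ = Cyc.length (V := V) ⟦p⟧ from h]
    refine Finset.sum_congr rfl fun a _ => ?_
    change List.count a _ = List.count a _
    congr!

theorem sum_visits (C : Multiset (Cyc V)) : ∑ a, visits C a = (C.map Cyc.length).sum := by
  induction C using Multiset.induction with
  | empty => simp [visits]
  | cons c C ih =>
    simp only [visits, Multiset.map_cons, Multiset.sum_cons, Finset.sum_add_distrib] at ih ⊢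
    rw [ih, Cyc.sum_visits]

variable [∀ a b : V, Fintype (a ⟶ b)]

theorem finite_cyc_length_le (N : ℕ) : {c : Cyc V | c.length ≤ N}.Finite := by
  have hfin : {p : ClosedWalk V | (edges p.path).length ≤ N}.Finite := by
    refine Set.Finite.of_finite_image (f := fun p : ClosedWalk V => edges p.path)
      ((List.finite_length_le (Edge V) N).subset ?_) ?_
    · rintro _ ⟨p, hp, rfl⟩
      exact hp
    · intro p _ q _ h
      exact ClosedWalk.eq_of_edges_eq p q h
  refine (hfin.image (fun p => (⟦p⟧ : Cyc V))).subset ?_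
  intro c hc
  induction c using Quotient.inductionOn with
  | _ p => exact ⟨p, hc, rfl⟩

/-- There are finitely many admissible multisets of cycles on a finite quiver. -/
instance Admissible.finite (n : V → ℕ) : Finite (Admissible n) := by
  set N := ∑ a, n a with hN
  set S : Set (Cyc V) := {c | c.length ≤ N} with hS
  have : Finite S := finite_cyc_length_le N
  have hfin := ((List.finite_length_le S N).image
    fun l : List S => ((l.map Subtype.val : List (Cyc V)) : Multiset (Cyc V)))
  refine Set.Finite.to_subtype (s := {C : Multiset (Cyc V) | ∀ a, visits C a ≤ n a})
    (hfin.subset ?_)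
  intro C hC
  have hsum : (C.map Cyc.length).sum ≤ N := by
    rw [← sum_visits]
    exact Finset.sum_le_sum fun a _ => hC a
  have hmem : ∀ c ∈ C, c ∈ S := fun c hc =>
    (Multiset.single_le_sum (fun _ _ => Nat.zero_le _) _
      (Multiset.mem_map_of_mem Cyc.length hc)).trans hsum
  have hcard : C.card ≤ N := by
    refine le_trans ?_ hsum
    have := Multiset.card_nsmul_le_sum (s := C.map Cyc.length) (a := 1) (by
      intro y hy
      obtain ⟨c, -, rfl⟩ := Multiset.mem_map.1 hy
      exact c.length_pos)
    simpa using this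
  induction C using Quotient.inductionOn with
  | _ l =>
    have hmem' : ∀ c ∈ l, c ∈ S := fun c hc => hmem c hc
    refine ⟨l.attachWith (· ∈ S) hmem', ?_, ?_⟩
    · simpa using hcard
    · simp

noncomputable instance Admissible.fintype (n : V → ℕ) : Fintype (Admissible n) :=
  Fintype.ofFinite _

/-! ### The Laplacian and the combinatorial weight -/

/-- The twisted Laplacian of a representation with edge weights `x`:
`(Δ f) a` is the sum over all edges `e` with source `a` of `x e * (f a - U e (f (target e)))`. -/
def laplacian {n : V → ℕ} (x : ∀ a b : V, (a ⟶ b) → ℂ) (U : Rep n) :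
    (∀ a : V, Fin (n a) → ℂ) →ₗ[ℂ] (∀ a : V, Fin (n a) → ℂ) where
  toFun f a := ∑ b, ∑ e : a ⟶ b, x a b e • (f a - (U a b e).mulVec (f b))
  map_add' f g := by
    funext a
    simp only [Pi.add_apply, ← Finset.sum_add_distrib, ← smul_add, Matrix.mulVec_add]
    refine Finset.sum_congr rfl fun b _ => Finset.sum_congr rfl fun e _ => ?_
    congr 1
    abel
  map_smul' r f := by
    funext a
    simp only [Pi.smul_apply, Matrix.mulVec_smul, RingHom.id_apply, Finset.smul_sum, ← smul_sub]
    refine Finset.sum_congr rfl fun b _ => Finset.sum_congr rfl fun e _ => ?_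
    rw [smul_comm]

/-- The sum of the weights of the edges with source `a`. -/
def outWeight (x : ∀ a b : V, (a ⟶ b) → ℂ) (a : V) : ℂ := ∑ b, ∑ e : a ⟶ b, x a b e

/-- The combinatorial weight of an admissible multiset of cycles. The subtraction of natural
numbers in the exponent is a true one, because the multiset is admissible. -/
noncomputable def weight {n : V → ℕ} (x : ∀ a b : V, (a ⟶ b) → ℂ) (C : Admissible n) : ℂ :=
  (∏ a, outWeight x a ^ (n a - visits C.1 a)) / (multFactorial C.1 : ℂ) *
    (C.1.map fun c => -c.monomial x / (c.valuation : ℂ)).prod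

end Finite

end QuiverRep

/-! The Laplacian is the matrix `z - A`, where `z` is scalar on the block of each vertex and `A` is
the adjacency matrix with entries twisted by `x` and `U`. The trace of `A ^ m` is a sum over based
closed paths of length `m`. A cycle of length `m` has `m / val` base points, counted as distinct
closed walks, so this trace is the sum over cycles of length `m` of `m / val` times the weight and
the holonomy trace.

Formally, `det (1 - A) = exp (-∑ Tr (A ^ m) / m)`, and expanding the exponential over cycles
produces all finite multisets with the factors `1 / C!` and `-1 / val`. To avoid power series, both
sides are compared degree by degree: the coefficients of `det (1 - X A)` satisfy Newton's identities
(`newton_charpolyRev`), and the graded pieces of the exponential satisfy the same recursion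
(`expTerm_recursion`).

Only admissible multisets survive. When the weight of each edge is multiplied by a variable attached
to its source, the variable of `a` occurs only in the `n a` rows above `a`, so the determinant has
degree at most `n a` in it, and the contributions of larger multidegree cancel
(`det_one_sub_adjacency_gradedWeight`). Substituting `1 / z` for the variables and multiplying by
`det z` gives the formula for invertible `z`, and by density for all `z`. The expectation then
follows by expanding the power and using linearity. -/

namespace QuiverRep

/-! ### Newton's identities for `det (1 - X M)`. -/

section Newton

open Polynomial

variable {R : Type*} [CommRing R] {ι : Type*} [Fintype ι] [DecidableEq ι]

/-- Jacobi's formula for the derivative of a determinant. -/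
theorem derivative_det (A : Matrix ι ι R[X]) :
    derivative A.det = (A.adjugate * A.map derivative).trace := by
  -- By Cramer's rule, each diagonal entry is a determinant with one column differentiated;
  -- Leibniz's rule yields the same sum.
  have h1 : (A.adjugate * A.map derivative).trace =
      ∑ i, (A.updateCol i fun k => derivative (A k i)).det := by
    refine Finset.sum_congr rfl fun i _ => ?_
    rw [← Matrix.cramer_apply, Matrix.cramer_eq_adjugate_mulVec]
    rfl
  rw [h1]
  simp only [Matrix.det_apply, derivative_sum, derivative_smul, derivative_prod_finset]
  rw [Finset.sum_comm]
  refine Finset.sum_congr rfl fun σ _ => ?_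
  rw [← Finset.smul_sum]
  congr 1
  refine Finset.sum_congr rfl fun i _ => ?_
  rw [← Finset.mul_prod_erase _ _ (Finset.mem_univ i), mul_comm]
  congr 1
  · simp
  · refine Finset.prod_congr rfl fun j hj => ?_
    rw [Matrix.updateCol_ne (Finset.ne_of_mem_erase hj)]

/-- Newton's identities for the reverse characteristic polynomial of a matrix. -/
theorem newton_charpolyRev (M : Matrix ι ι R) (N : ℕ) :
    ((N : R) + 1) * M.charpolyRev.coeff (N + 1) =
      -∑ j ∈ Finset.range (N + 1), M.charpolyRev.coeff j * (M ^ (N - j + 1)).trace := by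
  -- `K m` is the matrix coefficient of `X ^ m` in `adj B`. Comparing coefficients in `adj B * B =
  -- det B` gives a recursion that determines `K`. By Jacobi's formula, the derivative of `det B`
  -- has coefficients `-Tr (K N * M)`.
  set B : Matrix ι ι R[X] := 1 - (X : R[X]) • M.map C with hB
  set K : ℕ → Matrix ι ι R := fun m => B.adjugate.map (fun p => p.coeff m) with hK
  have hmul : B.adjugate * B = M.charpolyRev • (1 : Matrix ι ι R[X]) := Matrix.adjugate_mul B
  have hmul' : B.adjugate - (X : R[X]) • (B.adjugate * M.map C) =
      M.charpolyRev • (1 : Matrix ι ι R[X]) := by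
    rw [← hmul]
    nth_rw 3 [hB]
    rw [Matrix.mul_sub, Matrix.mul_one, Matrix.mul_smul]
  have hKM : ∀ m i j, ((B.adjugate * M.map C) i j).coeff m = (K m * M) i j := by
    intro m i j
    simp [Matrix.mul_apply, hK]
  have hK0 : K 0 = M.charpolyRev.coeff 0 • 1 := by
    ext i j
    have h := congrArg (fun A : Matrix ι ι R[X] => (A i j).coeff 0) hmul'
    by_cases hij : i = j
    · subst hij; simpa [hK] using h
    · simpa [hK, hij] using h
  have hKs : ∀ m, K (m + 1) = K m * M + M.charpolyRev.coeff (m + 1) • 1 := by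
    intro m
    ext i j
    have h := congrArg (fun A : Matrix ι ι R[X] => (A i j).coeff (m + 1)) hmul'
    simp only [Matrix.sub_apply, Matrix.smul_apply, smul_eq_mul, coeff_sub, coeff_X_mul,
      hKM] at h
    rw [Matrix.add_apply, ← sub_eq_iff_eq_add']
    refine Eq.trans h ?_
    by_cases hij : i = j
    · subst hij; simp
    · simp [hij]
  have hKsum : ∀ m, K m = ∑ j ∈ Finset.range (m + 1), M.charpolyRev.coeff j • M ^ (m - j) := by
    intro m
    induction m with
    | zero => simp [hK0]
    | succ m ih =>
      rw [hKs, ih, Finset.sum_range_succ _ (m + 1), Finset.sum_mul]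
      congr 1
      · refine Finset.sum_congr rfl fun j hj => ?_
        rw [Matrix.smul_mul, ← pow_succ, Nat.succ_sub (Finset.mem_range_succ_iff.1 hj)]
      · simp
  have hd : derivative M.charpolyRev = -(B.adjugate * M.map C).trace := by
    have hB' : B.map derivative = -M.map C := by
      ext i j : 2
      by_cases hij : i = j
      · subst hij; simp [hB]
      · simp [hB, hij]
    rw [Matrix.charpolyRev, derivative_det, hB', Matrix.mul_neg, Matrix.trace_neg]
  have hc := congrArg (fun p : R[X] => p.coeff N) hd
  simp only [coeff_derivative, coeff_neg, Matrix.trace, Matrix.diag, finsetSum_coeff, hKM] at hc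
  rw [mul_comm, hc]
  change -(K N * M).trace = _
  rw [hKsum, Finset.sum_mul, Matrix.trace_sum]
  simp [pow_succ]

/-- Evaluation at `X = 1`. The degree bound by the matrix size makes the expansion a finite sum. -/
theorem det_one_sub_eq_sum_coeff_charpolyRev (M : Matrix ι ι R) (d : ℕ)
    (hd : Fintype.card ι ≤ d) :
    (1 - M).det = ∑ N ∈ Finset.range (d + 1), M.charpolyRev.coeff N := by
  have h1 : M.charpolyRev.eval 1 = (1 - M).det := by
    rw [Matrix.charpolyRev, ← coe_evalRingHom, RingHom.map_det]
    congr 1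
    ext i j
    by_cases hij : i = j
    · subst hij; simp
    · simp [hij]
  have hdeg : M.charpolyRev.natDegree ≤ d := by
    nontriviality R
    rw [← Matrix.reverse_charpoly]
    refine (reverse_natDegree_le _).trans ?_
    rw [Matrix.charpoly_natDegree_eq_dim]
    exact hd
  rw [← h1, eval_eq_sum_range' (Nat.lt_succ_of_le hdeg)]
  simp

end Newton

/-! ### Exponential expansion over multisets. -/

section Multisets

open Finset

variable {ι : Type*} [DecidableEq ι] {K : Type*} [Field K] [CharZero K]
  {R : Type*} [CommRing R] [Algebra K R]

/-- The term of a multiset in the expansion of the exponential of a sum. -/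
noncomputable def expTerm (K : Type*) [Field K] [Algebra K R] (w : ι → R) (C : Multiset ι) : R :=
  ((∏ c ∈ C.toFinset, (C.count c)! : ℕ) : K)⁻¹ • (C.map w).prod

omit [CharZero K] in
theorem expTerm_zero (w : ι → R) : expTerm K w 0 = 1 := by simp [expTerm]

/-- Only the factor at `c` changes, from `m!` to `(m + 1)!`. Elements that are absent contribute `0!
= 1`, so both products can run over the same support. -/
theorem prod_factorial_count_cons (c : ι) (C : Multiset ι) :
    ∏ d ∈ (c ::ₘ C).toFinset, ((c ::ₘ C).count d)! =
      (C.count c + 1) * ∏ d ∈ C.toFinset, (C.count d)! := by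
  have h : ∀ D : Multiset ι, D.toFinset ⊆ (c ::ₘ C).toFinset →
      ∏ d ∈ D.toFinset, (D.count d)! = ∏ d ∈ (c ::ₘ C).toFinset, (D.count d)! := by
    intro D hD
    refine Finset.prod_subset hD fun d _ hd => ?_
    rw [Multiset.count_eq_zero_of_notMem (by simpa using hd), Nat.factorial_zero]
  rw [h C (by simp)]
  have hc : c ∈ (c ::ₘ C).toFinset := by simp
  rw [← Finset.mul_prod_erase _ _ hc, ← Finset.mul_prod_erase _ (fun d => (C.count d)!) hc,
    Multiset.count_cons_self, Nat.factorial_succ, mul_assoc]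
  congr 2
  refine Finset.prod_congr rfl fun d hd => ?_
  rw [Multiset.count_cons_of_ne (Finset.ne_of_mem_erase hd)]

theorem count_smul_expTerm_cons (w : ι → R) (c : ι) (C : Multiset ι) :
    ((c ::ₘ C).count c : R) * expTerm K w (c ::ₘ C) = w c * expTerm K w C := by
  have hne : ((C.count c + 1 : ℕ) : K) ≠ 0 := Nat.cast_ne_zero.2 (Nat.succ_ne_zero _)
  rw [expTerm, expTerm, prod_factorial_count_cons, Multiset.count_cons_self, Multiset.map_cons,
    Multiset.prod_cons, ← nsmul_eq_mul, ← Nat.cast_smul_eq_nsmul K, smul_smul, Nat.cast_mul,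
    mul_inv, mul_inv_cancel_left₀ hne, mul_smul_comm]

/-- The recursion satisfied by the graded components of the exponential of a sum. -/
theorem expTerm_recursion (ℓ : ι → ℕ) (hℓ : ∀ c, 0 < ℓ c) (w : ι → R)
    (S : ℕ → Finset ι) (hS : ∀ m c, c ∈ S m ↔ ℓ c = m)
    (T : ℕ → Finset (Multiset ι)) (hT : ∀ m C, C ∈ T m ↔ (C.map ℓ).sum = m) (N : ℕ) :
    ((N : R) + 1) * ∑ C ∈ T (N + 1), expTerm K w C =
      ∑ j ∈ range (N + 1), (∑ c ∈ S (N - j + 1), (ℓ c : R) * w c) * ∑ C ∈ T j, expTerm K w C := by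
  -- The total length `N + 1` is the sum of `count c * ℓ c`; each factor `count c` is absorbed by
  -- removing one copy of `c`.
  have hN : ∀ C ∈ T (N + 1), ((N : R) + 1) * expTerm K w C =
      ∑ c ∈ C.toFinset, (ℓ c : R) * w c * expTerm K w (C.erase c) := by
    intro C hC
    have h1 : ((N : R) + 1) = ∑ c ∈ C.toFinset, (C.count c : R) * (ℓ c : R) := by
      have h := (hT _ _).1 hC
      rw [Finset.sum_multiset_map_count] at h
      have := congrArg (Nat.cast : ℕ → R) h
      push_cast [smul_eq_mul] at this
      exact this.symm
    rw [h1, Finset.sum_mul]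
    refine Finset.sum_congr rfl fun c hc => ?_
    have h2 := count_smul_expTerm_cons (K := K) w c (C.erase c)
    rw [Multiset.cons_erase (Multiset.mem_toFinset.1 hc)] at h2
    rw [mul_assoc (ℓ c : R), ← h2]
    ring
  rw [Finset.mul_sum, Finset.sum_congr rfl hN]
  simp only [Finset.sum_mul_sum]
  simp only [← Finset.sum_product']
  rw [Finset.sum_sigma', Finset.sum_sigma']
  -- A multiset with a marked element `c` corresponds to the pair of `c` and the multiset with one
  -- copy of `c` removed.
  refine Finset.sum_bij'
    (fun p _ => ⟨((p.1.erase p.2).map ℓ).sum, (p.2, p.1.erase p.2)⟩)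
    (fun q _ => ⟨q.2.1 ::ₘ q.2.2, q.2.1⟩) ?_ ?_ ?_ ?_ ?_
  · rintro ⟨C, c⟩ h
    simp only [mem_sigma, Multiset.mem_toFinset, hT] at h
    have h3 : ℓ c + ((C.erase c).map ℓ).sum = N + 1 := by
      rw [← h.1]
      conv_rhs => rw [← Multiset.cons_erase h.2]
      simp
    have := hℓ c
    simp only [mem_sigma, mem_range, mem_product, hS, hT, and_true]
    omega
  · rintro ⟨j, c, C⟩ h
    simp only [mem_sigma, mem_range, mem_product, hS, hT] at h
    simp only [mem_sigma, hT, Multiset.map_cons, Multiset.sum_cons, Multiset.mem_toFinset,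
      Multiset.mem_cons, true_or, and_true]
    omega
  · rintro ⟨C, c⟩ h
    simp only [mem_sigma, Multiset.mem_toFinset] at h
    simp [Multiset.cons_erase h.2]
  · rintro ⟨j, c, C⟩ h
    simp only [mem_sigma, mem_range, mem_product, hS, hT] at h
    simp [h.2.2]
  · rintro ⟨C, c⟩ h
    rfl

/-- If the weighted power sums of a graded family are minus the traces of the powers of a matrix,
the coefficients of its reverse characteristic polynomial are the graded components of the
exponential of the sum of the family. -/
theorem coeff_charpolyRev_eq_sum_expTerm {κ : Type*} [Fintype κ] [DecidableEq κ]
    (M : Matrix κ κ R) (ℓ : ι → ℕ) (hℓ : ∀ c, 0 < ℓ c) (w : ι → R)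
    (S : ℕ → Finset ι) (hS : ∀ m c, c ∈ S m ↔ ℓ c = m)
    (T : ℕ → Finset (Multiset ι)) (hT : ∀ m C, C ∈ T m ↔ (C.map ℓ).sum = m)
    (hM : ∀ m, 0 < m → ∑ c ∈ S m, (ℓ c : R) * w c = -(M ^ m).trace) (N : ℕ) :
    M.charpolyRev.coeff N = ∑ C ∈ T N, expTerm K w C := by
  induction N using Nat.strong_induction_on with
  | _ N ih =>
    rcases N with _ | N
    · have h0 : T 0 = {0} := by
        ext C
        rw [hT, Finset.mem_singleton]
        refine ⟨fun h => ?_, fun h => by simp [h]⟩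
        refine Multiset.eq_zero_of_forall_notMem fun c hc => ?_
        exact (hℓ c).ne' (Multiset.sum_eq_zero_iff.1 h _ (Multiset.mem_map_of_mem ℓ hc))
      rw [h0, Finset.sum_singleton, expTerm_zero, Polynomial.coeff_zero_eq_eval_zero,
        Matrix.eval_charpolyRev]
    · have h1 := newton_charpolyRev M N
      have h2 := expTerm_recursion (K := K) ℓ hℓ w S hS T hT N
      have h3 : ((N : R) + 1) * M.charpolyRev.coeff (N + 1) =
          ((N : R) + 1) * ∑ C ∈ T (N + 1), expTerm K w C := by
        rw [h1, h2, ← Finset.sum_neg_distrib]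
        refine Finset.sum_congr rfl fun j hj => ?_
        rw [hM _ (Nat.succ_pos _), ih j (Finset.mem_range.1 hj)]
        ring
      -- `R` may have zero divisors; `N + 1` is cancelled because it comes from a unit of the field
      -- `K`.
      have h4 : ((N : R) + 1) = algebraMap K R (N + 1 : ℕ) := by simp
      rw [h4, ← Algebra.smul_def, ← Algebra.smul_def] at h3
      have hne : ((N + 1 : ℕ) : K) ≠ 0 := Nat.cast_ne_zero.2 (Nat.succ_ne_zero _)
      simpa only [smul_smul, inv_mul_cancel₀ hne, one_smul] using
        congrArg (fun r => ((N + 1 : ℕ) : K)⁻¹ • r) h3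

end Multisets

end QuiverRep

namespace QuiverRep

/-! ### Powers of the adjacency matrix as sums over paths. -/

section Paths

open Finset

variable {V : Type u} [Quiver.{v} V]

section Finiteness

variable [Fintype V] [∀ a b : V, Fintype (a ⟶ b)]

open Classical in
/-- The finite set of the paths of a given length from `a` to `b`. -/
noncomputable def pathFinset (a : V) : ℕ → (b : V) → Finset (Quiver.Path a b)
  | 0, b => if h : a = b then {h ▸ Quiver.Path.nil} else ∅
  | m + 1, b => (univ.sigma fun c : V => pathFinset a m c ×ˢ (univ : Finset (c ⟶ b))).map
      ⟨fun q => q.2.1.cons q.2.2, by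
        rintro ⟨c, p, e⟩ ⟨c', p', e'⟩ h
        simp only [Quiver.Path.cons.injEq] at h
        obtain ⟨rfl, h1, h2⟩ := h
        cases h1
        cases h2
        rfl⟩

theorem mem_pathFinset {a : V} (m : ℕ) {b : V} (p : Quiver.Path a b) :
    p ∈ pathFinset a m b ↔ p.length = m := by
  induction m generalizing b with
  | zero =>
    unfold pathFinset
    constructor
    · split_ifs with h
      · subst h
        intro hp
        rw [Finset.mem_singleton.1 hp]
        rfl
      · simp
    · intro hp
      obtain rfl := Quiver.Path.eq_of_length_zero p hp
      simpa using Quiver.Path.eq_nil_of_length_zero p hp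
  | succ m ih =>
    unfold pathFinset
    cases p with
    | nil => simp
    | @cons c _ p e =>
      simp only [mem_map, mem_sigma, mem_univ, mem_product, and_true, true_and, ih,
        Quiver.Path.length_cons, Nat.add_right_cancel_iff]
      constructor
      · rintro ⟨⟨c', p', e'⟩, h1, h2⟩
        replace h2 : p'.cons e' = p.cons e := h2
        simp only [Quiver.Path.cons.injEq] at h2
        obtain ⟨rfl, h2, -⟩ := h2
        cases h2
        exact h1
      · intro h
        exact ⟨⟨c, p, e⟩, h, rfl⟩

theorem sum_pathFinset_zero {A : Type*} [AddCommMonoid A] (a : V)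
    (f : Quiver.Path a a → A) : ∑ p ∈ pathFinset a 0 a, f p = f .nil := by
  simp [pathFinset]

theorem pathFinset_zero_of_ne {a b : V} (h : a ≠ b) : pathFinset a 0 b = ∅ := by
  simp [pathFinset, h]

theorem sum_pathFinset_succ {A : Type*} [AddCommMonoid A] (a b : V) (m : ℕ)
    (f : Quiver.Path a b → A) :
    ∑ p ∈ pathFinset a (m + 1) b, f p =
      ∑ c, ∑ p ∈ pathFinset a m c, ∑ e : c ⟶ b, f (p.cons e) := by
  rw [pathFinset, sum_map, sum_sigma]
  exact Finset.sum_congr rfl fun c _ => Finset.sum_product _ _ _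

end Finiteness

variable {R : Type*} [CommRing R]

/-- The product of the weights of the edges of a path. -/
def edgeProd (y : ∀ a b : V, (a ⟶ b) → R) {a b : V} (p : Quiver.Path a b) : R :=
  ((edges p).map fun e => y e.1 e.2.1 e.2.2).prod

/-- The product of the weights of the edges of a cycle. -/
def Cyc.edgeProd (y : ∀ a b : V, (a ⟶ b) → R) (c : Cyc V) : R :=
  Quotient.lift (fun p : ClosedWalk V => QuiverRep.edgeProd y p.path)
    (fun _ _ h => List.Perm.prod_eq ((List.IsRotated.perm h).map _)) c

variable [Fintype V] [∀ a b : V, Fintype (a ⟶ b)] [Algebra ℂ R]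

/-- The weighted adjacency matrix of a representation. -/
def adjacency {n : V → ℕ} (y : ∀ a b : V, (a ⟶ b) → R) (U : Rep n) :
    Matrix (Σ a, Fin (n a)) (Σ a, Fin (n a)) R :=
  fun p q => ∑ e : p.1 ⟶ q.1, y _ _ e * algebraMap ℂ R (U _ _ e p.2 q.2)

omit [Fintype V] in
theorem adjacency_apply {n : V → ℕ} (y : ∀ a b : V, (a ⟶ b) → R) (U : Rep n) (a b : V)
    (i : Fin (n a)) (j : Fin (n b)) :
    adjacency y U ⟨a, i⟩ ⟨b, j⟩ = ∑ e : a ⟶ b, y a b e * algebraMap ℂ R (U a b e i j) := rfl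

omit [Fintype V] [∀ a b : V, Fintype (a ⟶ b)] in
theorem hol_cons_apply {n : V → ℕ} (U : Rep n) {a b c : V} (p : Quiver.Path a b) (e : b ⟶ c)
    (i : Fin (n a)) (j : Fin (n c)) :
    hol U (p.cons e) i j = ∑ k, hol U p i k * U _ _ e k j := rfl

theorem adjacency_pow [DecidableEq V] {n : V → ℕ} (y : ∀ a b : V, (a ⟶ b) → R) (U : Rep n)
    (m : ℕ) (a b : V) (i : Fin (n a)) (j : Fin (n b)) :
    (adjacency y U ^ m) ⟨a, i⟩ ⟨b, j⟩ =
      ∑ p ∈ pathFinset a m b, edgeProd y p * algebraMap ℂ R (hol U p i j) := by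
  induction m generalizing b j with
  | zero =>
    by_cases hab : a = b
    · subst hab
      rw [sum_pathFinset_zero, pow_zero, Matrix.one_apply]
      by_cases hij : i = j
      · subst hij; simp [edgeProd, edges, hol]
      · simp [edgeProd, edges, hol, hij]
    · rw [pathFinset_zero_of_ne hab, sum_empty, pow_zero, Matrix.one_apply_ne]
      intro h
      exact hab (congrArg Sigma.fst h)
  | succ m ih =>
    rw [pow_succ, Matrix.mul_apply, Fintype.sum_sigma, sum_pathFinset_succ]
    refine Finset.sum_congr rfl fun c _ => ?_
    simp only [ih, adjacency_apply, Finset.sum_mul_sum]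
    rw [Finset.sum_comm]
    refine Finset.sum_congr rfl fun p _ => ?_
    refine Eq.trans Finset.sum_comm ?_
    refine Finset.sum_congr rfl fun e _ => ?_
    rw [hol_cons_apply, map_sum, Finset.mul_sum]
    refine Finset.sum_congr rfl fun k _ => ?_
    simp only [edgeProd, edges, List.map_append, List.map_cons, List.map_nil, List.prod_append,
      List.prod_singleton, map_mul]
    ring

end Paths

/-! ### From based closed paths to cycles. -/

section Cycles

open Finset

variable {V : Type u} [Quiver.{v} V]

theorem Cyc.mk_eq_mk {p q : ClosedWalk V} :
    (⟦p⟧ : Cyc V) = ⟦q⟧ ↔ (edges p.path).IsRotated (edges q.path) := Quotient.eq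

theorem Cyc.length_mk (p : ClosedWalk V) : Cyc.length (V := V) ⟦p⟧ = p.path.length :=
  length_edges p.path

/-- Every rotation of the edge sequence of a closed walk is the edge sequence of a closed walk. -/
theorem ClosedWalk.exists_rotate (p : ClosedWalk V) (i : ℕ) (hi : i < (edges p.path).length) :
    ∃ q : ClosedWalk V, edges q.path = (edges p.path).rotate i := by
  obtain ⟨c, r, s, hp, hr, hs⟩ :=
    exists_comp_of_edges_eq_append p.path _ _ (List.take_append_drop i (edges p.path)).symm
  have hpos : 0 < (s.comp r).length := by
    have := p.pos
    rw [hp] at this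
    simpa [add_comm] using this
  refine ⟨⟨c, s.comp r, hpos⟩, ?_⟩
  rw [edges_comp, hr, hs, List.rotate_eq_drop_append_take hi.le]

/-- The left side counts a coset of the stabilizer of `l`; translation by `j` modulo the length is
the bijection. -/
theorem card_rotate_eq_rotate {α : Type*} (l : List α) (j : ℕ) :
    Nat.card {i : Fin l.length // l.rotate i = l.rotate j} =
      Nat.card {i : Fin l.length // l.rotate i = l} := by
  rcases Nat.eq_zero_or_pos l.length with h0 | hpos
  · obtain rfl := List.eq_nil_of_length_eq_zero h0
    simp
  have : NeZero l.length := ⟨hpos.ne'⟩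
  refine (Nat.card_congr ((Equiv.addRight (Fin.ofNat l.length j)).subtypeEquiv fun i => ?_)).symm
  rw [Equiv.coe_addRight, Fin.val_add, Fin.val_ofNat, List.rotate_mod, ← List.rotate_rotate]
  have h := List.rotate_mod (l.rotate i) j
  rw [List.length_rotate] at h
  rw [h, List.rotate_eq_rotate]

/-- Orbit-stabilizer for the rotations of a cycle: the number of closed walks that represent it,
times its valuation, is its length. -/
theorem card_closedWalk_mul_valuation (c : Cyc V) (s : Finset (ClosedWalk V))
    (hs : ∀ p, p ∈ s ↔ (⟦p⟧ : Cyc V) = c) : s.card * c.valuation = c.length := by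
  classical
  induction c using Quotient.inductionOn with
  | _ p =>
    change s.card * Nat.card {i : Fin (edges p.path).length //
      (edges p.path).rotate i = edges p.path} = (edges p.path).length
    choose g hg using fun i : Fin (edges p.path).length => p.exists_rotate i i.2
    have hmaps : ∀ i ∈ (univ : Finset (Fin (edges p.path).length)), g i ∈ s := by
      intro i _
      rw [hs, Cyc.mk_eq_mk, hg]
      exact (List.IsRotated.forall _ _)
    have h := Finset.card_eq_sum_card_fiberwise hmaps
    -- Rotations map onto the representatives of the cycle, and every fibre is a coset of the
    -- stabilizer, of size the valuation.
    rw [Finset.card_univ, Fintype.card_fin] at h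
    refine Eq.trans (Finset.sum_const_nat fun q hq => ?_).symm h.symm
    rw [hs, Cyc.mk_eq_mk] at hq
    obtain ⟨j, hj⟩ := hq.symm
    refine Eq.trans ?_ (card_rotate_eq_rotate (edges p.path) j)
    rw [Nat.card_eq_fintype_card, Fintype.card_subtype]
    congr 1
    ext i
    simp only [mem_filter, mem_univ, true_and]
    rw [hj, ← hg]
    exact ⟨fun h => by rw [h], fun h => ClosedWalk.eq_of_edges_eq _ _ h⟩

theorem Cyc.valuation_pos (c : Cyc V) : 0 < c.valuation := by
  induction c using Quotient.inductionOn with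
  | _ p =>
    change 0 < Nat.card {i : Fin (edges p.path).length // (edges p.path).rotate i = edges p.path}
    have : Nonempty {i : Fin (edges p.path).length //
        (edges p.path).rotate i = edges p.path} :=
      ⟨⟨0, (length_edges p.path).symm ▸ p.pos⟩, by simp⟩
    exact Nat.card_pos

variable [Fintype V] [∀ a b : V, Fintype (a ⟶ b)]

/-- The finite set of the cycles of a given length. -/
noncomputable def cycFinset (V : Type u) [Quiver.{v} V] [Fintype V]
    [∀ a b : V, Fintype (a ⟶ b)] (m : ℕ) : Finset (Cyc V) :=
  Set.Finite.toFinset (s := {c : Cyc V | c.length = m})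
    ((finite_cyc_length_le m).subset fun _ hc => le_of_eq hc)

theorem mem_cycFinset (m : ℕ) (c : Cyc V) : c ∈ cycFinset V m ↔ c.length = m := by
  simp [cycFinset]

theorem finite_closedWalk_length_eq (m : ℕ) :
    {p : ClosedWalk V | p.path.length = m}.Finite := by
  refine Set.Finite.of_finite_image (f := fun p : ClosedWalk V => edges p.path)
    ((List.finite_length_le (Edge V) m).subset ?_) ?_
  · rintro _ ⟨p, hp, rfl⟩
    exact (length_edges p.path).trans_le (le_of_eq hp)
  · intro p _ q _ h
    exact ClosedWalk.eq_of_edges_eq p q h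

/-- The sum of a function over the based closed paths of a given length, in terms of cycles. -/
theorem sum_pathFinset_eq_sum_cycFinset {R : Type*} [CommRing R] [Algebra ℂ R] (f : Cyc V → R)
    (m : ℕ) (g : ∀ a : V, Quiver.Path a a → R)
    (hg : ∀ p : ClosedWalk V, g p.base p.path = f ⟦p⟧) (hm : 0 < m) :
    ∑ a, ∑ p ∈ pathFinset a m a, g a p =
      ∑ c ∈ cycFinset V m, (c.length : R) * ((c.valuation : ℂ)⁻¹ • f c) := by
  classical
  set W : Finset (ClosedWalk V) := (finite_closedWalk_length_eq (V := V) m).toFinset with hW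
  have hWm : ∀ p, p ∈ W ↔ p.path.length = m := fun p => by simp [hW]
  have h1 : ∑ a, ∑ p ∈ pathFinset a m a, g a p = ∑ p ∈ W, f ⟦p⟧ := by
    rw [Finset.sum_sigma']
    refine Finset.sum_bij'
      (fun q hq => ⟨q.1, q.2, by
        rw [(mem_pathFinset m q.2).1 (Finset.mem_sigma.1 hq).2]; exact hm⟩)
      (fun p _ => ⟨p.base, p.path⟩) ?_ ?_ ?_ ?_ ?_
    · intro q hq
      rw [hWm]
      exact (mem_pathFinset m q.2).1 (Finset.mem_sigma.1 hq).2
    · intro p hp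
      rw [Finset.mem_sigma]
      exact ⟨Finset.mem_univ _, (mem_pathFinset m p.path).2 ((hWm p).1 hp)⟩
    · intro q _
      rfl
    · intro p _
      rfl
    · intro q hq
      exact hg ⟨q.1, q.2, _⟩
  -- Closed walks are grouped by cycle; each class has `length / valuation` elements.
  rw [h1, ← Finset.sum_fiberwise_of_maps_to (t := cycFinset V m)
    (g := fun p : ClosedWalk V => (⟦p⟧ : Cyc V))]
  · refine Finset.sum_congr rfl fun c hc => ?_
    rw [mem_cycFinset] at hc
    have hcard := card_closedWalk_mul_valuation c (W.filter fun p => (⟦p⟧ : Cyc V) = c) (by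
      intro p
      rw [mem_filter, hWm, ← Cyc.length_mk]
      exact ⟨fun h => h.2, fun h => ⟨by rw [h, hc], h⟩⟩)
    have hv : (c.valuation : ℂ) ≠ 0 := Nat.cast_ne_zero.2 c.valuation_pos.ne'
    rw [Finset.sum_congr rfl fun p hp => by rw [(Finset.mem_filter.1 hp).2], Finset.sum_const,
      ← hcard, ← nsmul_eq_mul, ← Nat.cast_smul_eq_nsmul ℂ, ← Nat.cast_smul_eq_nsmul ℂ, smul_smul,
      Nat.cast_mul, mul_inv_cancel_right₀ hv]
    rfl
  · intro p hp
    exact (mem_cycFinset m ⟦p⟧).2 ((Cyc.length_mk p).trans ((hWm p).1 hp))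

/-- The contribution of a cycle to the logarithm of the determinant. -/
noncomputable def Cyc.logTerm {R : Type*} [CommRing R] [Algebra ℂ R] {n : V → ℕ}
    (y : ∀ a b : V, (a ⟶ b) → R) (U : Rep n) (c : Cyc V) : R :=
  (c.valuation : ℂ)⁻¹ • -(c.edgeProd y * algebraMap ℂ R (c.traceHol U))

theorem sum_logTerm_eq_neg_trace [DecidableEq V] {R : Type*} [CommRing R] [Algebra ℂ R]
    {n : V → ℕ} (y : ∀ a b : V, (a ⟶ b) → R) (U : Rep n) (m : ℕ) (hm : 0 < m) :
    ∑ c ∈ cycFinset V m, (c.length : R) * c.logTerm y U = -(adjacency y U ^ m).trace := by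
  have h : (adjacency y U ^ m).trace =
      ∑ a, ∑ p ∈ pathFinset a m a, edgeProd y p * algebraMap ℂ R (hol U p).trace := by
    rw [Matrix.trace, Fintype.sum_sigma]
    refine Finset.sum_congr rfl fun a _ => ?_
    simp only [Matrix.diag, adjacency_pow]
    rw [Finset.sum_comm]
    refine Finset.sum_congr rfl fun p _ => ?_
    rw [Matrix.trace, map_sum, Finset.mul_sum]
    rfl
  rw [h, sum_pathFinset_eq_sum_cycFinset (fun c => c.edgeProd y * algebraMap ℂ R (c.traceHol U))
    m (fun a p => edgeProd y p * algebraMap ℂ R (hol U p).trace) (fun p => rfl) hm,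
    ← Finset.sum_neg_distrib]
  refine Finset.sum_congr rfl fun c _ => ?_
  rw [Cyc.logTerm, smul_neg, mul_neg]

/-- Visits at a vertex are bounded by the total length, so these multisets are admissible for the
constant rank `N`. -/
theorem finite_multiset_length_eq (N : ℕ) :
    {C : Multiset (Cyc V) | (C.map Cyc.length).sum = N}.Finite := by
  refine (Set.finite_range fun C : Admissible (fun _ : V => N) => C.1).subset fun C hC => ?_
  refine ⟨⟨C, fun a => ?_⟩, rfl⟩
  rw [← show _ = N from hC, ← sum_visits]
  exact Finset.single_le_sum (f := fun a => visits C a) (fun _ _ => Nat.zero_le _)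
    (Finset.mem_univ a)

/-- The finite set of the multisets of cycles of a given total length. -/
noncomputable def multisetFinset (V : Type u) [Quiver.{v} V] [Fintype V]
    [∀ a b : V, Fintype (a ⟶ b)] (N : ℕ) : Finset (Multiset (Cyc V)) :=
  (finite_multiset_length_eq N).toFinset

theorem mem_multisetFinset (N : ℕ) (C : Multiset (Cyc V)) :
    C ∈ multisetFinset V N ↔ (C.map Cyc.length).sum = N := by
  simp [multisetFinset]

/-- The expansion of `det (1 - M)` for a weighted adjacency matrix `M`, over the multisets of
cycles of bounded total length. -/
theorem det_one_sub_adjacency [DecidableEq V] [DecidableEq (Cyc V)] {R : Type*} [CommRing R] [Algebra ℂ R]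
    {n : V → ℕ} (y : ∀ a b : V, (a ⟶ b) → R) (U : Rep n) :
    (1 - adjacency y U).det = ∑ N ∈ range (∑ a, n a + 1), ∑ C ∈ multisetFinset V N,
      expTerm ℂ (fun c => c.logTerm y U) C := by
  rw [det_one_sub_eq_sum_coeff_charpolyRev _ (∑ a, n a) (by simp)]
  refine Finset.sum_congr rfl fun N _ => ?_
  exact coeff_charpolyRev_eq_sum_expTerm _ Cyc.length Cyc.length_pos _ (cycFinset V)
    mem_cycFinset (multisetFinset V) mem_multisetFinset
    (fun m hm => sum_logTerm_eq_neg_trace y U m hm) N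

end Cycles

end QuiverRep

namespace QuiverRep

/-! ### Multigrading by vertices and truncation to admissible multisets. -/

section Graded

open Finset MvPolynomial

variable {V : Type u} [Quiver.{v} V] [Fintype V]

/-- The visits of a multiset of cycles, as a multidegree. -/
noncomputable def visitDegree (C : Multiset (Cyc V)) : V →₀ ℕ :=
  Finsupp.equivFunOnFinite.symm (visits C)

theorem visitDegree_apply (C : Multiset (Cyc V)) (a : V) : visitDegree C a = visits C a := rfl

/-- The edge weights, graded by the source of the edge. -/
noncomputable def gradedWeight (x : ∀ a b : V, (a ⟶ b) → ℂ) (a b : V) (e : a ⟶ b) :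
    MvPolynomial V ℂ := X a * C (x a b e)

/-- The coefficient of a multiset of cycles in the expansion of the determinant. -/
noncomputable def holWeight {n : V → ℕ} (x : ∀ a b : V, (a ⟶ b) → ℂ) (U : Rep n)
    (C : Multiset (Cyc V)) : ℂ :=
  (multFactorial C : ℂ)⁻¹ *
    (C.map fun c => -c.monomial x / (c.valuation : ℂ) * c.traceHol U).prod

theorem Cyc.edgeProd_gradedWeight (x : ∀ a b : V, (a ⟶ b) → ℂ) (c : Cyc V) :
    c.edgeProd (gradedWeight x) =
      MvPolynomial.monomial (Finsupp.equivFunOnFinite.symm c.visits) (c.monomial x) := by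
  classical
  induction c using Quotient.inductionOn with
  | _ p =>
    have key : ∀ l : List (Edge V), (l.map fun e => gradedWeight x e.1 e.2.1 e.2.2).prod =
        MvPolynomial.monomial
          (Finsupp.equivFunOnFinite.symm fun a => (l.map fun e => e.1).count a)
          (l.map fun e => x e.1 e.2.1 e.2.2).prod := by
      intro l
      induction l with
      | nil =>
        have h0 : (Finsupp.equivFunOnFinite.symm fun _ => 0 : V →₀ ℕ) = 0 := by
          ext a; rfl
        simp [h0]
      | cons e l ih =>
        rw [List.map_cons, List.prod_cons, ih, gradedWeight, mul_comm (X _), C_mul_X_eq_monomial,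
          monomial_mul, List.map_cons, List.map_cons, List.prod_cons]
        congr 2
        ext a
        simp [List.count_cons, Finsupp.single_apply, add_comm]
    refine (key (edges p.path)).trans ?_
    congr 2

theorem expTerm_logTerm_eq_monomial [∀ a b : V, Fintype (a ⟶ b)] [DecidableEq (Cyc V)]
    {n : V → ℕ} (x : ∀ a b : V, (a ⟶ b) → ℂ)
    (U : Rep n) (D : Multiset (Cyc V)) :
    expTerm ℂ (fun c => c.logTerm (gradedWeight x) U) D =
      MvPolynomial.monomial (visitDegree D) (holWeight x U D) := by
  have h1 : (D.map fun c => c.logTerm (gradedWeight x) U).prod =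
      MvPolynomial.monomial (visitDegree D)
        (D.map fun c => -c.monomial x / (c.valuation : ℂ) * c.traceHol U).prod := by
    induction D using Multiset.induction with
    | empty =>
      have h0 : visitDegree (0 : Multiset (Cyc V)) = 0 := by
        ext a; simp [visitDegree_apply, visits]
      simp [h0]
    | cons c D ih =>
      have h0 : visitDegree (c ::ₘ D) = Finsupp.equivFunOnFinite.symm c.visits +
          visitDegree D := by
        ext a; simp [visitDegree_apply, visits]
      rw [Multiset.map_cons, Multiset.prod_cons, ih, Multiset.map_cons, Multiset.prod_cons, h0,
        ← monomial_mul, Cyc.logTerm, Cyc.edgeProd_gradedWeight, algebraMap_eq, mul_comm _ (C _),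
        C_mul_monomial, ← map_neg, smul_monomial]
      congr 2
      rw [smul_eq_mul]
      ring
  rw [expTerm, h1, smul_monomial, holWeight, smul_eq_mul, multFactorial]
  congr!

/-- The multidegree of `det (1 - M)` for the graded weighted adjacency matrix `M`. -/
theorem degreeOf_det_one_sub_adjacency_le [DecidableEq V] [∀ a b : V, Fintype (a ⟶ b)] {n : V → ℕ}
    (x : ∀ a b : V, (a ⟶ b) → ℂ) (U : Rep n) (a : V) :
    (1 - adjacency (gradedWeight x) U).det.degreeOf a ≤ n a := by
  -- The variable of `a` occurs only in the rows above `a`, with degree at most one; a Leibniz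
  -- product takes one entry from each of these `n a` rows.
  have hentry : ∀ p q : Σ a, Fin (n a),
      ((1 - adjacency (gradedWeight x) U) p q).degreeOf a ≤ if p.1 = a then 1 else 0 := by
    intro p q
    rw [Matrix.sub_apply]
    refine (degreeOf_sub_le _ _ _).trans (max_le ?_ ?_)
    · rw [Matrix.one_apply]
      split_ifs <;> simp
    · refine (degreeOf_sum_le _ _ _).trans (Finset.sup_le fun e _ => ?_)
      rw [gradedWeight, algebraMap_eq, mul_assoc, ← C_mul]
      refine (degreeOf_mul_le _ _ _).trans ?_
      rw [degreeOf_C, add_zero, degreeOf_X]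
      simp only [eq_comm, le_refl]
  rw [Matrix.det_apply]
  refine (degreeOf_sum_le _ _ _).trans (Finset.sup_le fun σ _ => ?_)
  have hsign : ∀ P : MvPolynomial V ℂ, (Equiv.Perm.sign σ • P).degreeOf a ≤ P.degreeOf a := by
    intro P
    rcases Int.units_eq_one_or (Equiv.Perm.sign σ) with h | h <;> simp [h, degreeOf_neg]
  refine (hsign _).trans ?_
  refine (degreeOf_prod_le _ _ _).trans ?_
  refine (Finset.sum_le_sum fun p _ => hentry (σ p) p).trans ?_
  rw [Equiv.sum_comp σ fun p : Σ a, Fin (n a) => if p.1 = a then 1 else 0, Fintype.sum_sigma]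
  have hblock : ∀ b : V, ∑ _i : Fin (n b), (if b = a then 1 else 0) = if b = a then n b else 0 := by
    intro b
    split_ifs <;> simp
  exact (Finset.sum_congr rfl fun b _ => hblock b).trans_le (by simp)

/-- The expansion of `det (1 - M)` for the graded weighted adjacency matrix `M`: only the
admissible multisets of cycles contribute. -/
theorem det_one_sub_adjacency_gradedWeight [DecidableEq V] [∀ a b : V, Fintype (a ⟶ b)]
    {n : V → ℕ} (x : ∀ a b : V, (a ⟶ b) → ℂ) (U : Rep n) :
    (1 - adjacency (gradedWeight x) U).det =
      ∑ D : Admissible n, MvPolynomial.monomial (visitDegree D.1) (holWeight x U D.1) := by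
  classical
  have hdet := det_one_sub_adjacency (gradedWeight x) U
  simp only [expTerm_logTerm_eq_monomial] at hdet
  rw [Finset.sum_sigma'] at hdet
  ext v
  -- In an admissible multidegree, the two sums run over the same multisets: the total length is the
  -- sum of the visits, hence within the cutoff `∑ a, n a`.
  by_cases hv : ∀ a, v a ≤ n a
  · rw [hdet, coeff_sum, coeff_sum]
    simp only [coeff_monomial]
    rw [← Finset.sum_filter, ← Finset.sum_filter]
    have hvis : ∀ D : Multiset (Cyc V), visitDegree D = v → ∀ a, visits D a = v a :=
      fun D h a => by rw [← h, visitDegree_apply]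
    refine Finset.sum_bij' (fun p hp => ⟨p.2, fun a => ?_⟩)
      (fun D _ => ⟨(D.1.map Cyc.length).sum, D.1⟩) ?_ ?_ ?_ ?_ ?_
    · exact (hvis _ (Finset.mem_filter.1 hp).2 a).trans_le (hv a)
    · intro p hp
      exact Finset.mem_filter.2 ⟨Finset.mem_univ _, (Finset.mem_filter.1 hp).2⟩
    · intro D hD
      refine Finset.mem_filter.2 ⟨?_, (Finset.mem_filter.1 hD).2⟩
      rw [Finset.mem_sigma, Finset.mem_range, mem_multisetFinset, ← sum_visits]
      exact ⟨Nat.lt_succ_of_le (Finset.sum_le_sum fun a _ => D.2 a), rfl⟩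
    · rintro ⟨N, D⟩ hp
      have h := (Finset.mem_sigma.1 (Finset.mem_filter.1 hp).1).2
      rw [mem_multisetFinset] at h
      exact Sigma.ext h HEq.rfl
    · intro D _
      rfl
    · intro p _
      rfl
  · push Not at hv
    obtain ⟨a, ha⟩ := hv
    -- Individual multisets of this multidegree may contribute to `hdet`; the degree bound forces
    -- their sum to vanish.
    have h1 : coeff v (1 - adjacency (gradedWeight x) U).det = 0 := by
      by_contra h
      have h2 := monomial_le_degreeOf a (mem_support_iff.2 h)
      exact absurd (h2.trans (degreeOf_det_one_sub_adjacency_le x U a)) (not_le.2 ha)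
    rw [h1, coeff_sum]
    refine (Finset.sum_eq_zero fun D _ => ?_).symm
    rw [coeff_monomial, if_neg]
    rintro rfl
    exact absurd (D.2 a) (not_le.2 ha)

/-- The block diagonal matrix that is scalar on each block. -/
def blockScalar [DecidableEq V] (n : V → ℕ) (z : V → ℂ) :
    Matrix (Σ a, Fin (n a)) (Σ a, Fin (n a)) ℂ :=
  Matrix.diagonal fun p => z p.1

/-- Evaluation of the graded identity at `X a = t a`: left multiplication by the block scalar matrix
scales each row by the value at its vertex. -/
theorem det_one_sub_blockScalar_mul [DecidableEq V] [∀ a b : V, Fintype (a ⟶ b)]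
    {n : V → ℕ} (x : ∀ a b : V, (a ⟶ b) → ℂ) (U : Rep n) (t : V → ℂ) :
    (1 - blockScalar n t * adjacency x U).det =
      ∑ D : Admissible n, (∏ a, t a ^ visits D.1 a) * holWeight x U D.1 := by
  have h := congrArg (MvPolynomial.eval t) (det_one_sub_adjacency_gradedWeight x U)
  rw [RingHom.map_det, map_sum] at h
  convert h using 2
  · ext p q
    by_cases hpq : p = q
    · subst hpq
      simp [blockScalar, adjacency, gradedWeight, Finset.mul_sum, mul_assoc]
    · simp [blockScalar, adjacency, gradedWeight, Finset.mul_sum, mul_assoc, hpq]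
  · rw [eval_monomial, Finsupp.prod_fintype _ _ fun a => pow_zero _, mul_comm]
    rfl

omit [Quiver.{v} V] in
theorem det_blockScalar [DecidableEq V] (n : V → ℕ) (z : V → ℂ) :
    (blockScalar n z).det = ∏ a, z a ^ n a := by
  simp [blockScalar, Matrix.det_diagonal, Fintype.prod_sigma]

/-- The expansion of the characteristic polynomial of a weighted adjacency matrix, with one
variable for each vertex, over the admissible multisets of cycles. -/
theorem det_blockScalar_sub_adjacency [DecidableEq V] [∀ a b : V, Fintype (a ⟶ b)]
    {n : V → ℕ} (x : ∀ a b : V, (a ⟶ b) → ℂ) (U : Rep n) (z : V → ℂ) :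
    (blockScalar n z - adjacency x U).det =
      ∑ D : Admissible n, (∏ a, z a ^ (n a - visits D.1 a)) * holWeight x U D.1 := by
  -- Factoring out `z` requires every `z a` to be nonzero, which may fail for the out-weights. Both
  -- sides are continuous in `z`, so a dense set suffices.
  have hdense : Dense {z : V → ℂ | ∀ a, z a ≠ 0} := by
    have h := dense_pi (Set.univ : Set V) (s := fun _ : V => ({0}ᶜ : Set ℂ))
      fun _ _ => dense_compl_singleton 0
    convert h using 1
    ext z
    simp
  have hcont : Continuous fun z : V → ℂ => (blockScalar n z - adjacency x U).det := by
    refine Continuous.matrix_det (Continuous.sub ?_ continuous_const)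
    exact Continuous.matrix_diagonal (continuous_pi fun p => continuous_apply p.1)
  have hcont' : Continuous fun z : V → ℂ =>
      ∑ D : Admissible n, (∏ a, z a ^ (n a - visits D.1 a)) * holWeight x U D.1 := by
    fun_prop
  refine congrFun (Continuous.ext_on hdense hcont hcont' fun z hz => ?_) z
  have hz' : ∀ a, z a ≠ 0 := hz
  have hfac : blockScalar n z - adjacency x U =
      blockScalar n z * (1 - blockScalar n (fun a => (z a)⁻¹) * adjacency x U) := by
    rw [mul_sub, mul_one, ← mul_assoc]
    congr 1
    ext p q
    simp [blockScalar, hz']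
  rw [hfac, Matrix.det_mul, det_one_sub_blockScalar_mul, det_blockScalar, Finset.mul_sum]
  refine Finset.sum_congr rfl fun D _ => ?_
  rw [← mul_assoc, ← Finset.prod_mul_distrib]
  congr 1
  refine Finset.prod_congr rfl fun a _ => ?_
  rw [pow_sub₀ _ (hz' a) (D.2 a), inv_pow]

end Graded

/-! ### The determinant of the Laplacian. -/

section Laplacian

variable {V : Type u} [Quiver.{v} V] [Fintype V] [∀ a b : V, Fintype (a ⟶ b)]

theorem det_laplacian_eq_det_matrix [DecidableEq V] {n : V → ℕ} (x : ∀ a b : V, (a ⟶ b) → ℂ)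
    (U : Rep n) :
    LinearMap.det (laplacian x U) = (blockScalar n (outWeight x) - adjacency x U).det := by
  rw [← LinearMap.det_toLin', ← LinearMap.det_conj (Matrix.toLin' _)
    (LinearEquiv.piCurry ℂ fun (a : V) (_ : Fin (n a)) => ℂ)]
  congr 1
  refine LinearMap.ext fun f => ?_
  funext a i
  simp only [LinearMap.comp_apply, LinearEquiv.coe_coe, Matrix.toLin'_apply, Matrix.sub_mulVec]
  change _ = (blockScalar n (outWeight x)).mulVec (fun p => f p.1 p.2) ⟨a, i⟩ -
    (adjacency x U).mulVec (fun p => f p.1 p.2) ⟨a, i⟩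
  rw [blockScalar, Matrix.mulVec_diagonal, Matrix.mulVec, dotProduct, Fintype.sum_sigma]
  simp only [laplacian, LinearMap.coe_mk, AddHom.coe_mk, Finset.sum_apply, Pi.smul_apply,
    Pi.sub_apply, smul_eq_mul, mul_sub, Finset.sum_sub_distrib, outWeight, Finset.sum_mul,
    adjacency_apply, Algebra.algebraMap_self, RingHom.id_apply]
  congr 1
  refine Finset.sum_congr rfl fun b _ => ?_
  rw [Finset.sum_comm]
  refine Finset.sum_congr rfl fun e _ => ?_
  simp only [Matrix.mulVec, dotProduct, Finset.mul_sum, mul_assoc]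

/-- The determinant of the Laplacian as a sum over the admissible multisets of cycles. -/
theorem det_laplacian {n : V → ℕ} (x : ∀ a b : V, (a ⟶ b) → ℂ) (U : Rep n) :
    LinearMap.det (laplacian x U) =
      ∑ D : Admissible n, weight x D * (D.1.map fun c => c.traceHol U).prod := by
  classical
  rw [det_laplacian_eq_det_matrix, det_blockScalar_sub_adjacency]
  refine Finset.sum_congr rfl fun D _ => ?_
  rw [weight, holWeight, Multiset.prod_map_mul]
  ring

end Laplacian

end QuiverRep

theorem theorem5p4 {V : Type u} [Quiver.{v} V] [Fintype V]
    [∀ a b : V, Fintype (a ⟶ b)]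
    -- the quiver has no self-loops
    (hloop : ∀ a : V, IsEmpty (a ⟶ a))
    (x : ∀ a b : V, (a ⟶ b) → ℂ)
    (n : V → ℕ) (hn : ∀ a, 1 ≤ n a)
    (μ : Measure (QuiverRep.Rep n)) [IsProbabilityMeasure μ]
    (k : ℕ) (hk : 1 ≤ k)
    -- the Wilson loop expectations exist
    (hint : ∀ C : Fin k → QuiverRep.Admissible n,
      Integrable (fun U : QuiverRep.Rep n =>
        ∏ i, ((C i).1.map fun c => c.traceHol U).prod) μ) :
    Integrable (fun U : QuiverRep.Rep n => (LinearMap.det (QuiverRep.laplacian x U)) ^ k) μ ∧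
    ∫ U, (LinearMap.det (QuiverRep.laplacian x U)) ^ k ∂μ =
      ∑ C : Fin k → QuiverRep.Admissible n,
        (∏ i, QuiverRep.weight x (C i)) *
          ∫ U, ∏ i, ((C i).1.map fun c => c.traceHol U).prod ∂μ := by
  have hpow : ∀ U : QuiverRep.Rep n, (LinearMap.det (QuiverRep.laplacian x U)) ^ k =
      ∑ C : Fin k → QuiverRep.Admissible n, (∏ i, QuiverRep.weight x (C i)) *
        ∏ i, ((C i).1.map fun c => c.traceHol U).prod := by
    intro U
    -- The power is written as a product over `Fin k`, so that distributivity gives a sum over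
    -- `k`-tuples of admissible multisets.
    rw [QuiverRep.det_laplacian, ← Fin.prod_const, Finset.prod_univ_sum,
      Fintype.piFinset_univ]
    simp only [Finset.prod_mul_distrib]
  have hterm : ∀ C : Fin k → QuiverRep.Admissible n, Integrable (fun U : QuiverRep.Rep n =>
      (∏ i, QuiverRep.weight x (C i)) * ∏ i, ((C i).1.map fun c => c.traceHol U).prod) μ :=
    fun C => (hint C).const_mul _
  simp only [hpow]
  refine ⟨integrable_finsetSum _ fun C _ => hterm C, ?_⟩
  rw [integral_finsetSum _ fun C _ => hterm C]
  simp only [integral_const_mul]
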